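/- Let $\Gamma=(V,E)$ be a connected simple graph with $|V|=r+1\ge 3$ vertices and $|E|=n\ge 3$ edges, and let $$F_\Gamma=\sum_{T}\prod_{i\in T}x_i\in\mathbb{R}[x_1,\dots,x_n]$$ be its Kirchhoff polynomial, with one variable $x_i$ for each edge, where $T$ runs over the (edge sets of) spanning trees of $\Gamma$. Put $$\operatorname{Ann}(F_\Gamma)=\{P\in\mathbb{R}[x_1,\dots,x_n] : P(\partial/\partial x_1,\dots,\partial/\partial x_n)F_\Gamma=0\},\qquad R_\Gamma=\mathbb{R}[x_1,\dots,x_n]/\operatorname{Ann}(F_\Gamma),$$ and let $R_\Gamma^\ell$ be the image in $R_\Gamma$ of the homogeneous polynomials of degree $\ell$. Then $R_\Gamma^r\neq 0$, $R_\Gamma^\ell=0$ for $\ell>r$, and for every $a=(a_1,\dots,a_n)\in(\mathbb{R}_{>0})^n$ the element $L_a=a_1x_1+\cdots+a_nx_n\in R_\Gamma^1$ has the strong Lefschetz property in degree one: multiplication by $L_a^{r-2}$ maps $R_\Gamma^1$ bijectively onto $R_\Gamma^{r-1}$. -/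

import Mathlib

namespace GraphLefschetz

open MvPolynomial

theorem pderiv_comm {σ : Type*} (i j : σ) (F : MvPolynomial σ ℝ) :
    pderiv i (pderiv j F) = pderiv j (pderiv i F) := by
  classical
  have h : ⁅pderiv (R := ℝ) i, pderiv (R := ℝ) j⁆ = 0 := by
    apply MvPolynomial.derivation_ext
    intro k
    rw [Derivation.commutator_apply, pderiv_X, pderiv_X]
    simp only [Pi.single_apply]
    split_ifs <;> simp
  have h2 := congrArg (fun D => D F) h
  rw [Derivation.commutator_apply] at h2
  exact sub_eq_zero.mp h2

/-- The set of the operators `∂/∂xᵢ` on `ℝ[xᵢ : i ∈ σ]`. -/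
def partials (σ : Type*) : Set (Module.End ℝ (MvPolynomial σ ℝ)) :=
  Set.range fun i : σ => (pderiv (R := ℝ) i : MvPolynomial σ ℝ →ₗ[ℝ] MvPolynomial σ ℝ)

theorem partials_comm (σ : Type*) :
    ∀ A ∈ partials σ, ∀ B ∈ partials σ, A * B = B * A := by
  rintro _ ⟨i, rfl⟩ _ ⟨j, rfl⟩
  exact LinearMap.ext fun F => pderiv_comm i j F

open scoped IsMulCommutative in
/-- The substitution `P ↦ P(∂/∂x₁, …, ∂/∂xₙ)`: the algebra homomorphism from the polynomial ring
to the linear operators on it which sends `xᵢ` to `∂/∂xᵢ`. It takes values in the commutative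
algebra that the partial derivatives generate. -/
noncomputable def diffOp (σ : Type*) :
    MvPolynomial σ ℝ →ₐ[ℝ] Module.End ℝ (MvPolynomial σ ℝ) :=
  haveI : IsMulCommutative (Algebra.adjoin ℝ (partials σ)) :=
    Algebra.isMulCommutative_adjoin ℝ (partials_comm σ)
  (Algebra.adjoin ℝ (partials σ)).val.comp
    (aeval fun i : σ => (⟨(pderiv (R := ℝ) i : MvPolynomial σ ℝ →ₗ[ℝ] MvPolynomial σ ℝ),
      Algebra.subset_adjoin ⟨i, rfl⟩⟩ : Algebra.adjoin ℝ (partials σ)))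

/-- Together with `diffOp` being an algebra homomorphism, this characterises it. -/
theorem diffOp_X {σ : Type*} (i : σ) (F : MvPolynomial σ ℝ) :
    diffOp σ (X i) F = pderiv i F := by
  simp [diffOp]

/-- `Ann(F) = {P | P(∂/∂x₁, …, ∂/∂xₙ) F = 0}`. -/
noncomputable def annIdeal {σ : Type*} (F : MvPolynomial σ ℝ) : Ideal (MvPolynomial σ ℝ) where
  carrier := {P | diffOp σ P F = 0}
  add_mem' {P Q} hP hQ := by
    change diffOp σ P F = 0 at hP
    change diffOp σ Q F = 0 at hQ
    change diffOp σ (P + Q) F = 0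
    rw [map_add, LinearMap.add_apply, hP, hQ, add_zero]
  zero_mem' := by simp
  smul_mem' Q P hP := by
    change diffOp σ P F = 0 at hP
    change diffOp σ (Q * P) F = 0
    rw [map_mul, Module.End.mul_apply, hP, map_zero]

/-- `R_F = ℝ[x₁, …, xₙ] / Ann(F)`. -/
abbrev GorensteinAlgebra {σ : Type*} (F : MvPolynomial σ ℝ) : Type _ :=
  MvPolynomial σ ℝ ⧸ annIdeal F

/-- The graded piece `R_F^ℓ`: the classes of the homogeneous polynomials of degree `ℓ`. -/
noncomputable def gradedPiece {σ : Type*} (F : MvPolynomial σ ℝ) (l : ℕ) :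
    Submodule ℝ (GorensteinAlgebra F) :=
  (homogeneousSubmodule σ ℝ l).map (Ideal.Quotient.mkₐ ℝ (annIdeal F)).toLinearMap

/-- The class `L_a` of `∑ aᵢ xᵢ` in `R_F`. -/
noncomputable def linearElement {σ : Type*} [Fintype σ] (F : MvPolynomial σ ℝ) (a : σ → ℝ) :
    GorensteinAlgebra F :=
  Ideal.Quotient.mk (annIdeal F) (∑ i, C (a i) * X i)

/-- For a graded algebra `R = R⁰ ⊕ ⋯ ⊕ Rʳ` with `Rʳ ≠ 0`, the element `L ∈ R¹` has the strong
Lefschetz property at degree `l` (where `2 l ≤ r`): multiplication by `L ^ (r - 2 l)` is a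
bijection from `Rˡ` onto `Rʳ⁻ˡ`. -/
structure StrongLefschetzAt {A : Type*} [CommRing A] [Algebra ℝ A]
    (R : ℕ → Submodule ℝ A) (r l : ℕ) (L : A) : Prop where
  top_ne_bot : R r ≠ ⊥
  eq_bot_of_lt : ∀ i, r < i → R i = ⊥
  two_mul_le : 2 * l ≤ r
  mem_one : L ∈ R 1
  bijOn : Set.BijOn (fun ξ : A => L ^ (r - 2 * l) * ξ) (R l) (R (r - l))

/-- The set `T` of edges of `G` is the edge set of a spanning tree of `G`. -/
def IsSpanningTree {V : Type*} (G : SimpleGraph V) (T : Finset G.edgeSet) : Prop :=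
  (SimpleGraph.fromEdgeSet ((fun e : G.edgeSet => (e : Sym2 V)) '' (T : Set G.edgeSet))).IsTree

open Classical in
/-- The Kirchhoff polynomial of `G`, with one variable for each edge:
the sum of `∏ e ∈ T, x_e` over the spanning trees `T` of `G`. -/
noncomputable def kirchhoffPolynomial {V : Type*} (G : SimpleGraph V) [Fintype G.edgeSet] :
    MvPolynomial G.edgeSet ℝ :=
  ∑ T : Finset G.edgeSet with IsSpanningTree G T, ∏ e ∈ T, X e

end GraphLefschetz

namespace GraphLefschetz

open MvPolynomial

/-! ### From the Lefschetz property to the Hessian. -/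

section DifferentialOperators

variable {σ : Type*}

/-! Write F for the Kirchhoff polynomial. For linear forms, letting the product x_i · L_a^(r-2) · ξ
act on F gives (r-2)! times the i-th entry of the Hessian of F at a applied to ξ. Since F(a) ≠ 0,
the theorem reduces to nonsingularity of that Hessian (`strongLefschetzAt_one_of_hessian`).

By the matrix tree theorem (`eval_kirchhoffPolynomial`), F(x) = det L(x), where L(x) = Wᵀ diag(x) W
is the weighted Laplacian reduced at a vertex. With G = W L(a)⁻¹ Wᵀ, the Hessian entries are
F(a)(G_ii G_jj - G_ij²) (`hessian_kirchhoffPolynomial`).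

Let ξ be in the kernel. Since G diag(a) is a projection of trace r, pairing with a gives (r-1) Σ
G_jj ξ_j = 0, and r ≥ 2 kills the sum. Pairing with ξ then leaves tr(L(a)⁻¹ M L(a)⁻¹ M) = 0 for M =
L(ξ). Positive definiteness of L(a) forces M = 0 (`eq_zero_of_dualGram`). The graph being simple,
the off-diagonal entries of the full Laplacian at edges are the -ξ_e, so ξ = 0. -/

theorem diffOp_C (c : ℝ) (F : MvPolynomial σ ℝ) : diffOp σ (C c) F = C c * F := by
  rw [← algebraMap_eq, AlgHom.commutes, Module.algebraMap_end_apply, algebraMap_eq, smul_eq_C_mul]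

theorem diffOp_mul (P Q F : MvPolynomial σ ℝ) :
    diffOp σ (P * Q) F = diffOp σ P (diffOp σ Q F) := by
  rw [map_mul, Module.End.mul_apply]

theorem pderiv_eq_zero_of_isHomogeneous_zero {F : MvPolynomial σ ℝ} (hF : F.IsHomogeneous 0)
    (i : σ) : pderiv i F = 0 := by
  rw [totalDegree_eq_zero_iff_eq_C.mp ((totalDegree_zero_iff_isHomogeneous _).mpr hF), pderiv_C]

variable [Fintype σ]

/-- Euler's identity. In the surjectivity argument it reduces equality of linear forms to equality
of their constant partial derivatives. -/
theorem eq_zero_of_pderiv_eq_zero {F : MvPolynomial σ ℝ} {d : ℕ} (hd : d ≠ 0)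
    (hF : F.IsHomogeneous d) (h : ∀ i, pderiv i F = 0) : F = 0 := by
  have := hF.sum_X_mul_pderiv
  simp only [h, mul_zero, Finset.sum_const_zero] at this
  rw [nsmul_eq_mul] at this
  rcases mul_eq_zero.mp this.symm with h | h
  · exact absurd (by exact_mod_cast h) hd
  · exact h

/-- A homogeneous differential operator of order `k` lowers the degree by `k`. -/
theorem isHomogeneous_diffOp {k : ℕ} {P : MvPolynomial σ ℝ} (hP : P.IsHomogeneous k) {d : ℕ}
    {F : MvPolynomial σ ℝ} (hF : F.IsHomogeneous d) :
    (diffOp σ P F).IsHomogeneous (d - k) ∧ (d < k → diffOp σ P F = 0) := by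
  induction k generalizing P d F with
  | zero =>
    rw [totalDegree_eq_zero_iff_eq_C.mp ((totalDegree_zero_iff_isHomogeneous _).mpr hP), diffOp_C]
    refine ⟨?_, fun h => absurd h (Nat.not_lt_zero d)⟩
    simpa using (isHomogeneous_C σ _).mul hF
  | succ k ih =>
    -- Euler's identity splits off one derivative, leaving operators of order k to act on the
    -- partials of F.
    have hPe : P = C ((k + 1 : ℝ)⁻¹) * ∑ i, pderiv i P * X i := by
      have h := hP.sum_X_mul_pderiv
      simp only [mul_comm (X _)] at h
      rw [h, nsmul_eq_mul, ← mul_assoc, ← map_natCast (C : ℝ →+* MvPolynomial σ ℝ), ← C_mul]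
      rw [show ((k + 1 : ℝ)⁻¹ * ((k + 1 : ℕ) : ℝ)) = 1 by push_cast; field_simp]
      simp
    have key : diffOp σ P F = C ((k + 1 : ℝ)⁻¹) * ∑ i, diffOp σ (pderiv i P) (pderiv i F) := by
      conv_lhs => rw [hPe]
      rw [diffOp_mul, diffOp_C, map_sum, LinearMap.sum_apply]
      simp only [diffOp_mul, diffOp_X]
    have hi : ∀ i, (pderiv i P).IsHomogeneous k := fun i => by simpa using hP.pderiv (i := i)
    rw [key]
    constructor
    · rw [← zero_add (d - (k + 1))]
      refine (isHomogeneous_C σ _).mul (IsHomogeneous.sum _ _ _ fun i _ => ?_)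
      have := (ih (hi i) (hF.pderiv (i := i))).1
      rwa [Nat.sub_sub, add_comm 1 k] at this
    · intro hd
      rw [Finset.sum_eq_zero, mul_zero]
      intro i _
      -- For d = 0 the degree d - 1 truncates to 0, so the induction hypothesis need not apply;
      -- there the partials of F already vanish.
      rcases Nat.eq_zero_or_pos d with rfl | hd0
      · rw [pderiv_eq_zero_of_isHomogeneous_zero hF, map_zero]
      · exact (ih (hi i) (hF.pderiv (i := i))).2 (by omega)

theorem isHomogeneous_linear (a : σ → ℝ) :
    (∑ i, C (a i) * X i : MvPolynomial σ ℝ).IsHomogeneous 1 :=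
  IsHomogeneous.sum _ _ _ fun i _ => by
    simpa using (isHomogeneous_C σ (a i)).mul (isHomogeneous_X ℝ i)

theorem diffOp_linear (a : σ → ℝ) (F : MvPolynomial σ ℝ) :
    diffOp σ (∑ i, C (a i) * X i) F = ∑ i, C (a i) * pderiv i F := by
  rw [map_sum, LinearMap.sum_apply]
  simp only [diffOp_mul, diffOp_X, diffOp_C]

/-- The `d`-th power of the derivative in the direction `a` sends a form `F` of degree `d` to the
constant `d! * F(a)`. -/
theorem diffOp_linear_pow (a : σ → ℝ) {d : ℕ} {F : MvPolynomial σ ℝ} (hF : F.IsHomogeneous d) :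
    diffOp σ ((∑ i, C (a i) * X i) ^ d) F = C (d.factorial * eval a F) := by
  induction d generalizing F with
  | zero =>
    obtain ⟨c, rfl⟩ : ∃ c, F = C c :=
      ⟨_, totalDegree_eq_zero_iff_eq_C.mp ((totalDegree_zero_iff_isHomogeneous _).mpr hF)⟩
    simp
  | succ d ih =>
    have h1 : (∑ i, C (a i) * pderiv i F).IsHomogeneous d :=
      IsHomogeneous.sum _ _ _ fun i _ => by
        simpa using (isHomogeneous_C σ (a i)).mul (hF.pderiv (i := i))
    have h2 := congrArg (eval a) hF.sum_X_mul_pderiv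
    simp only [map_sum, map_mul, eval_X, nsmul_eq_mul, map_natCast] at h2
    rw [pow_succ, diffOp_mul, diffOp_linear, ih h1]
    congr 1
    simp only [map_sum, map_mul, eval_C, h2, Nat.factorial_succ]
    push_cast
    ring

/-- If a form `F` of degree `r ≥ 2` does not vanish at `a` and has an invertible Hessian there,
then the linear form with coefficients `a` has the strong Lefschetz property at degree one. -/
theorem strongLefschetzAt_one_of_hessian {F : MvPolynomial σ ℝ} {r : ℕ} (hr : 2 ≤ r)
    (hF : F.IsHomogeneous r) (a : σ → ℝ) (hFa : eval a F ≠ 0)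
    (hH : ∀ ξ : σ → ℝ, (∀ i, ∑ j, eval a (pderiv i (pderiv j F)) * ξ j = 0) → ξ = 0) :
    StrongLefschetzAt (gradedPiece F) r 1 (linearElement F a) := by
  classical
  obtain ⟨s, rfl⟩ : ∃ s, r = s + 2 := ⟨r - 2, by omega⟩
  set A : MvPolynomial σ ℝ := ∑ i, C (a i) * X i with hA
  have hAh : A.IsHomogeneous 1 := isHomogeneous_linear a
  have mem_piece : ∀ {l : ℕ} {P : MvPolynomial σ ℝ}, P.IsHomogeneous l →
      Ideal.Quotient.mk (annIdeal F) P ∈ gradedPiece F l := fun {l P} hP =>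
    ⟨P, (mem_homogeneousSubmodule l P).mpr hP, rfl⟩
  have of_mem : ∀ {l : ℕ} {x : GorensteinAlgebra F}, x ∈ gradedPiece F l →
      ∃ P : MvPolynomial σ ℝ, P.IsHomogeneous l ∧ Ideal.Quotient.mk (annIdeal F) P = x := by
    rintro l x ⟨P, hP, rfl⟩
    exact ⟨P, (mem_homogeneousSubmodule l P).mp hP, rfl⟩
  have mk_eq : ∀ {P : MvPolynomial σ ℝ},
      Ideal.Quotient.mk (annIdeal F) P = 0 ↔ diffOp σ P F = 0 := Ideal.Quotient.eq_zero_iff_mem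
  -- Apply the two first-order operators before A ^ s: they leave a form of degree s, which A ^ s
  -- evaluates at a up to s!.
  have hess : ∀ (ξ : σ → ℝ) (i : σ), diffOp σ (X i * (A ^ s * ∑ j, C (ξ j) * X j)) F =
      C (s.factorial * ∑ j, eval a (pderiv i (pderiv j F)) * ξ j) := by
    intro ξ i
    have h1 : (∑ j, C (ξ j) * pderiv i (pderiv j F)).IsHomogeneous s :=
      IsHomogeneous.sum _ _ _ fun j _ => by
        simpa using (isHomogeneous_C σ (ξ j)).mul (hF.pderiv (i := j)).pderiv
    have h2 : X i * (A ^ s * ∑ j, C (ξ j) * X j) = A ^ s * (X i * ∑ j, C (ξ j) * X j) := by ring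
    rw [h2, diffOp_mul, diffOp_mul, diffOp_X, diffOp_linear, map_sum]
    simp only [pderiv_C_mul]
    rw [diffOp_linear_pow a h1]
    simp only [map_sum, map_mul, eval_C, mul_comm]
  have lin : ∀ {P : MvPolynomial σ ℝ}, P.IsHomogeneous 1 → ∃ ξ : σ → ℝ, P = ∑ j, C (ξ j) * X j := by
    intro P hP
    refine ⟨fun j => coeff 0 (pderiv j P), ?_⟩
    have h := hP.sum_X_mul_pderiv
    rw [one_smul] at h
    conv_lhs => rw [← h]
    refine Finset.sum_congr rfl fun j _ => ?_
    have : (pderiv j P).IsHomogeneous 0 := hP.pderiv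
    rw [mul_comm, ← totalDegree_eq_zero_iff_eq_C.mp ((totalDegree_zero_iff_isHomogeneous _).mpr this)]
  refine ⟨?_, ?_, by omega, mem_piece hAh, ?_, ?_, ?_⟩
  · intro h
    have h0 : Ideal.Quotient.mk (annIdeal F) (A ^ (s + 2)) = 0 := by
      have := mem_piece (by simpa using hAh.pow (s + 2) : (A ^ (s + 2)).IsHomogeneous (s + 2))
      rwa [h, Submodule.mem_bot] at this
    rw [mk_eq, diffOp_linear_pow a hF, C_eq_zero] at h0
    exact mul_ne_zero (by exact_mod_cast Nat.factorial_ne_zero _) hFa h0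
  · intro i hi
    rw [eq_bot_iff]
    intro x hx
    obtain ⟨P, hP, rfl⟩ := of_mem hx
    exact mk_eq.mpr ((isHomogeneous_diffOp hP hF).2 hi)
  · intro x hx
    obtain ⟨P, hP, rfl⟩ := of_mem hx
    have := mem_piece ((hAh.pow s).mul hP)
    simpa [linearElement, ← hA] using this
  · have inj : ∀ x ∈ gradedPiece F 1, linearElement F a ^ s * x = 0 → x = 0 := by
      intro x hx h
      obtain ⟨P, hP, rfl⟩ := of_mem hx
      obtain ⟨ξ, rfl⟩ := lin hP
      rw [linearElement, ← hA, ← map_pow, ← map_mul, mk_eq] at h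
      have : ξ = 0 := hH ξ fun i => by
        have h1 := hess ξ i
        rw [diffOp_mul, h, map_zero, eq_comm, C_eq_zero] at h1
        exact (mul_eq_zero.mp h1).resolve_left (by exact_mod_cast Nat.factorial_ne_zero _)
      simp [this]
    intro x hx y hy h
    rw [← sub_eq_zero]
    refine inj _ (sub_mem hx hy) ?_
    rw [mul_sub, sub_eq_zero]
    exact h
  · intro x hx
    obtain ⟨P, hP, rfl⟩ := of_mem hx
    replace hP : P.IsHomogeneous (s + 1) := hP
    set H : Matrix σ σ ℝ := Matrix.of fun i j => eval a (pderiv i (pderiv j F)) with hHdef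
    have Hinj : Function.Injective H.mulVec := by
      rw [← Matrix.coe_mulVecLin, injective_iff_map_eq_zero]
      intro ξ h
      exact hH ξ fun i => congrFun h i
    have Hsurj : Function.Surjective H.mulVec :=
      Matrix.mulVec_surjective_iff_isUnit.mpr (Matrix.mulVec_injective_iff_isUnit.mp Hinj)
    have hc : ∀ i, diffOp σ (X i * P) F = C (coeff 0 (diffOp σ (X i * P) F)) := fun i => by
      have h1 := (isHomogeneous_diffOp ((isHomogeneous_X ℝ i).mul hP) hF).1
      rw [show s + 2 - (1 + (s + 1)) = 0 by omega] at h1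
      exact totalDegree_eq_zero_iff_eq_C.mp ((totalDegree_zero_iff_isHomogeneous _).mpr h1)
    -- Solve the Hessian system so that A ^ s · ξ and P agree after multiplication by every
    -- variable; the inverse factorial cancels the one in `hess`.
    obtain ⟨ξ, hξ⟩ := Hsurj fun i => (s.factorial : ℝ)⁻¹ * coeff 0 (diffOp σ (X i * P) F)
    refine ⟨Ideal.Quotient.mk (annIdeal F) (∑ j, C (ξ j) * X j),
      mem_piece (isHomogeneous_linear ξ), ?_⟩
    change linearElement F a ^ s * _ = _
    rw [linearElement, ← hA, ← map_pow, ← map_mul, ← sub_eq_zero, ← map_sub, mk_eq]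
    have hQ : (A ^ s * (∑ j, C (ξ j) * X j) - P).IsHomogeneous (s + 1) := by
      refine IsHomogeneous.sub ?_ hP
      simpa using (hAh.pow s).mul (isHomogeneous_linear ξ)
    have hQF := (isHomogeneous_diffOp hQ hF).1
    refine eq_zero_of_pderiv_eq_zero (by omega) hQF fun i => ?_
    rw [← diffOp_X, ← diffOp_mul, mul_sub, map_sub, LinearMap.sub_apply, hess, hc, sub_eq_zero]
    congr 1
    have h1 : ∑ j, eval a (pderiv i (pderiv j F)) * ξ j =
        (s.factorial : ℝ)⁻¹ * coeff 0 (diffOp σ (X i * P) F) := congrFun hξ i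
    rw [h1, ← mul_assoc, mul_inv_cancel₀ (by exact_mod_cast Nat.factorial_ne_zero _), one_mul]

end DifferentialOperators

end GraphLefschetz
namespace GraphLefschetz

open Matrix

/-! ### Weighted Gram matrices, their determinants, and the kernel computation. -/

section LinearAlgebra

set_option linter.unusedSectionVars false

variable {E m : Type*} [Fintype E] [DecidableEq E] [Fintype m] [DecidableEq m]

/-- The matrix `∑ e, x e • wₑᵀ wₑ`, where `wₑ` are the rows of `W`. -/
def weightedGram {R : Type*} [CommRing R] (W : Matrix E m R) (x : E → R) : Matrix m m R :=
  Wᵀ * diagonal x * W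

theorem weightedGram_apply {R : Type*} [CommRing R] (W : Matrix E m R) (x : E → R) (i j : m) :
    weightedGram W x i j = ∑ e, x e * (W e i * W e j) := by
  rw [weightedGram, Matrix.mul_apply]
  refine Finset.sum_congr rfl fun e _ => ?_
  rw [mul_diagonal, transpose_apply]
  ring

theorem weightedGram_transpose {R : Type*} [CommRing R] (W : Matrix E m R) (x : E → R) :
    (weightedGram W x)ᵀ = weightedGram W x := by
  simp [weightedGram, Matrix.mul_assoc]

theorem weightedGram_add_single {R : Type*} [CommRing R] (W : Matrix E m R) (x : E → R) (e : E)
    (t : R) : weightedGram W (x + Pi.single e t) =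
      weightedGram W x + t • vecMulVec (W e) (W e) := by
  ext i j
  simp only [weightedGram_apply, Pi.add_apply, add_mul, Finset.sum_add_distrib, Matrix.add_apply,
    Matrix.smul_apply, vecMulVec_apply, smul_eq_mul]
  congr 1
  rw [Finset.sum_eq_single e]
  · simp
  · intro b _ hb
    simp [hb]
  · simp

/-- Multilinearity of the determinant in the rows, each a combination of rows of `W`: Cauchy–Binet
before the choices are grouped by image. -/
theorem det_weightedGram_expand {R : Type*} [CommRing R] (W : Matrix E m R) (x : E → R) :
    (weightedGram W x).det =
      ∑ f : m → E, (∏ i, x (f i)) * ((∏ i, W (f i) i) * (W.submatrix f id).det) := by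
  have h : weightedGram W x = fun i => ∑ e, (x e * W e i) • W e := by
    funext i j
    rw [weightedGram_apply]
    simp [Finset.sum_apply, mul_assoc]
  rw [h]
  change (detRowAlternating (R := R)).toMultilinearMap _ = _
  rw [MultilinearMap.map_sum]
  refine Finset.sum_congr rfl fun f _ => ?_
  rw [MultilinearMap.map_smul_univ, Finset.prod_mul_distrib, smul_eq_mul, mul_assoc]
  rfl

/-- The determinant of `weightedGram W x` is a multiaffine form in `x`. -/
theorem det_weightedGram {R : Type*} [CommRing R] (W : Matrix E m R) (x : E → R) :
    (weightedGram W x).det = ∑ S ∈ Finset.powersetCard (Fintype.card m) (Finset.univ : Finset E),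
      (∏ e ∈ S, x e) * (weightedGram W fun e => if e ∈ S then 1 else 0).det := by
  have hinj : ∀ f : m → E, ¬ Function.Injective f → (W.submatrix f id).det = 0 := by
    intro f hf
    simp only [Function.Injective, not_forall] at hf
    obtain ⟨i, j, hij, hne⟩ := hf
    exact det_zero_of_row_eq hne (by ext k; simp [hij])
  have hexp : ∀ y : E → R, (weightedGram W y).det =
      ∑ f : m → E with Function.Injective f,
        (∏ i, y (f i)) * ((∏ i, W (f i) i) * (W.submatrix f id).det) := by
    intro y
    rw [det_weightedGram_expand, Finset.sum_filter]
    refine Finset.sum_congr rfl fun f _ => ?_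
    split_ifs with hf
    · rfl
    · rw [hinj f hf, mul_zero, mul_zero]
  have hmaps : ∀ f ∈ (Finset.univ.filter fun f : m → E => Function.Injective f),
      Finset.univ.image f ∈ Finset.powersetCard (Fintype.card m) (Finset.univ : Finset E) := by
    intro f hf
    rw [Finset.mem_powersetCard, Finset.card_image_of_injective _ (Finset.mem_filter.mp hf).2]
    exact ⟨Finset.subset_univ _, rfl⟩
  -- Group the injective choices by image S; the fibre over S is the same expansion at the indicator
  -- weights of S.
  rw [hexp, ← Finset.sum_fiberwise_of_maps_to hmaps]
  refine Finset.sum_congr rfl fun S hS => ?_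
  rw [hexp, Finset.mul_sum, ← Finset.sum_filter_add_sum_filter_not
    (Finset.univ.filter fun f : m → E => Function.Injective f) (fun f => Finset.univ.image f = S)
    (f := fun f => (∏ e ∈ S, x e) * _)]
  rw [Finset.sum_eq_zero (s := Finset.filter (fun f => ¬ Finset.univ.image f = S) _), add_zero]
  · refine Finset.sum_congr rfl fun f hf => ?_
    simp only [Finset.mem_filter, Finset.mem_univ, true_and] at hf
    obtain ⟨hf, rfl⟩ := hf
    rw [Finset.prod_image fun i _ j _ h => hf h]
    simp
  · intro f hf
    simp only [Finset.mem_filter, Finset.mem_univ, true_and] at hf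
    obtain ⟨hf, hS'⟩ := hf
    -- An injective choice with image other than S leaves S, by cardinality, so an indicator factor
    -- vanishes.
    obtain ⟨i, hi⟩ : ∃ i, f i ∉ S := by
      by_contra! h
      refine hS' (Finset.eq_of_subset_of_card_le ?_ ?_)
      · intro e he
        obtain ⟨i, -, rfl⟩ := Finset.mem_image.mp he
        exact h i
      · rw [Finset.card_image_of_injective _ hf, (Finset.mem_powersetCard.mp hS).2]
        simp
    rw [Finset.prod_eq_zero (f := fun i => if f i ∈ S then (1 : R) else 0) (Finset.mem_univ i)
      (by simp [hi]), zero_mul, mul_zero]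

variable (W : Matrix E m ℝ)

theorem posSemidef_weightedGram {x : E → ℝ} (hx : ∀ e, 0 ≤ x e) :
    (weightedGram W x).PosSemidef := by
  have h : (diagonal x).PosSemidef := posSemidef_diagonal_iff.mpr hx
  simpa [weightedGram] using h.conjTranspose_mul_mul_same W

theorem posDef_weightedGram {x : E → ℝ} (hx : ∀ e, 0 ≤ x e) (h : (weightedGram W x).det ≠ 0) :
    (weightedGram W x).PosDef :=
  (posSemidef_weightedGram W hx).posDef_iff_isUnit.mpr
    ((isUnit_iff_isUnit_det _).mpr (isUnit_iff_ne_zero.mpr h))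

/-- The matrix of the inner products of the rows of `W` for the dual form of `L`. -/
noncomputable def dualGram (L : Matrix m m ℝ) : Matrix E E ℝ := W * L⁻¹ * Wᵀ

theorem dualGram_comm {L : Matrix m m ℝ} (hL : Lᵀ = L) (e f : E) :
    dualGram W L f e = dualGram W L e f := by
  have : (dualGram W L)ᵀ = dualGram W L := by
    simp [dualGram, transpose_nonsing_inv, hL, Matrix.mul_assoc]
  exact congrFun (congrFun this e) f

/-- The matrix determinant lemma: raising the weights of a few edges by one is a low-rank update,
which the dual Gram matrix measures. -/
theorem det_add_rows {ι : Type*} [Fintype ι] [DecidableEq ι] {L : Matrix m m ℝ}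
    (hL : IsUnit L.det) (f : ι → E) :
    (L + (W.submatrix f id)ᵀ * W.submatrix f id).det =
      L.det * (1 + (dualGram W L).submatrix f f).det := by
  rw [det_add_mul _ _ hL]
  rfl

theorem det_add_row {L : Matrix m m ℝ} (hL : IsUnit L.det) (e : E) :
    (L + vecMulVec (W e) (W e)).det = L.det * (1 + dualGram W L e e) := by
  have h : vecMulVec (W e) (W e) = (W.submatrix ![e] id)ᵀ * W.submatrix ![e] id := by
    ext i j
    rw [Matrix.mul_apply]
    simp only [transpose_apply, submatrix_apply]
    simp [vecMulVec_apply]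
  rw [h, det_add_rows W hL, det_fin_one]
  rfl

theorem det_add_two_rows {L : Matrix m m ℝ} (hL : IsUnit L.det) (e f : E) :
    (L + vecMulVec (W e) (W e) + vecMulVec (W f) (W f)).det = L.det *
      ((1 + dualGram W L e e) * (1 + dualGram W L f f) - dualGram W L e f * dualGram W L f e) := by
  have h : vecMulVec (W e) (W e) + vecMulVec (W f) (W f) =
      (W.submatrix ![e, f] id)ᵀ * W.submatrix ![e, f] id := by
    ext i j
    rw [Matrix.mul_apply]
    simp only [transpose_apply, submatrix_apply, Fin.sum_univ_two]
    simp [vecMulVec_apply]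
  rw [add_assoc, h, det_add_rows W hL, det_fin_two]
  simp only [Matrix.add_apply, submatrix_apply]
  simp

open scoped MatrixOrder in
-- Factoring L⁻¹ = BᵀB turns the trace into the squared Frobenius norm of the symmetric matrix B M
-- Bᵀ.
theorem eq_zero_of_trace_eq_zero {L M : Matrix m m ℝ} (hL : L.PosDef) (hM : Mᵀ = M)
    (h : (L⁻¹ * M * L⁻¹ * M).trace = 0) : M = 0 := by
  obtain ⟨B, hB⟩ := CStarAlgebra.nonneg_iff_eq_star_mul_self.mp hL.inv.posSemidef.nonneg
  rw [star_eq_conjTranspose, conjTranspose_eq_transpose_of_trivial] at hB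
  have h1 : ((B * M * Bᵀ)ᴴ * (B * M * Bᵀ)).trace = 0 := by
    rw [conjTranspose_eq_transpose_of_trivial, ← h, hB, transpose_mul, transpose_mul,
      transpose_transpose, hM, Matrix.mul_assoc, trace_mul_comm]
    simp only [Matrix.mul_assoc]
    rw [trace_mul_comm M]
    simp only [Matrix.mul_assoc]
  have h2 := trace_conjTranspose_mul_self_eq_zero_iff.mp h1
  have h3 : L⁻¹ * M * L⁻¹ = 0 := by
    rw [hB, show Bᵀ * B * M * (Bᵀ * B) = Bᵀ * (B * M * Bᵀ) * B by simp only [Matrix.mul_assoc], h2]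
    simp
  have hu : IsUnit L.det := (isUnit_iff_isUnit_det _).mp hL.isUnit
  have h4 : L * (L⁻¹ * M * L⁻¹) * L = M := by
    rw [Matrix.mul_assoc L⁻¹, mul_nonsing_inv_cancel_left _ _ hu, nonsing_inv_mul_cancel_right _ _ hu]
  rw [← h4, h3]
  simp

theorem eq_zero_of_dualGram {a : E → ℝ} (hm : Fintype.card m ≠ 1)
    (hL : (weightedGram W a).PosDef) (hW : ∀ ξ : E → ℝ, weightedGram W ξ = 0 → ξ = 0) {ξ : E → ℝ}
    (hξ : ∀ i, ∑ j, (dualGram W (weightedGram W a) i i * dualGram W (weightedGram W a) j j -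
      dualGram W (weightedGram W a) i j ^ 2) * ξ j = 0) : ξ = 0 := by
  have hu : IsUnit (weightedGram W a).det := (isUnit_iff_isUnit_det _).mp hL.isUnit
  set G := dualGram W (weightedGram W a) with hG
  have hsymm : ∀ i j, G j i = G i j := dualGram_comm W (weightedGram_transpose W a)
  have hproj : ∀ j, ∑ i, a i * G i j ^ 2 = G j j := by
    intro j
    have : G * diagonal a * G = G := by
      calc G * diagonal a * G
          = W * ((weightedGram W a)⁻¹ * weightedGram W a) * (weightedGram W a)⁻¹ * Wᵀ := by
            simp only [hG, dualGram, weightedGram, Matrix.mul_assoc]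
        _ = G := by rw [nonsing_inv_mul _ hu, Matrix.mul_one]; rfl
    have h := congrFun (congrFun this j) j
    rw [Matrix.mul_apply] at h
    rw [← h]
    refine Finset.sum_congr rfl fun i _ => ?_
    rw [mul_diagonal, hsymm i j]
    ring
  have htr : ∑ i, a i * G i i = Fintype.card m := by
    have : (G * diagonal a).trace = Fintype.card m := by
      rw [hG, dualGram, Matrix.mul_assoc, Matrix.mul_assoc, trace_mul_comm, Matrix.mul_assoc]
      change ((weightedGram W a)⁻¹ * weightedGram W a).trace = _
      rw [nonsing_inv_mul _ hu, trace_one]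
    rw [← this]
    simp [trace, mul_diagonal, mul_comm]
  -- Pair the kernel equations with a: the trace contributes m, the projection identity subtracts 1,
  -- and m ≠ 1.
  have hlin : ∑ j, G j j * ξ j = 0 := by
    have h : ∑ i, a i * ∑ j, (G i i * G j j - G i j ^ 2) * ξ j =
        (Fintype.card m - 1) * ∑ j, G j j * ξ j := by
      simp only [Finset.mul_sum]
      rw [Finset.sum_comm]
      refine Finset.sum_congr rfl fun j _ => ?_
      calc ∑ i, a i * ((G i i * G j j - G i j ^ 2) * ξ j)
          = ((∑ i, a i * G i i) * G j j - ∑ i, a i * G i j ^ 2) * ξ j := by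
            rw [Finset.sum_mul, ← Finset.sum_sub_distrib, Finset.sum_mul]
            exact Finset.sum_congr rfl fun i _ => by ring
        _ = _ := by rw [htr, hproj]; ring
    simp only [hξ, mul_zero, Finset.sum_const_zero] at h
    refine (mul_eq_zero.mp h.symm).resolve_left ?_
    rw [sub_eq_zero]
    exact_mod_cast hm
  -- Pair with ξ; by `hlin` the square of the linear term drops out.
  have hquad : ∑ i, ∑ j, G i j * ξ j * (G j i * ξ i) = 0 := by
    have h : ∑ i, ξ i * ∑ j, (G i i * G j j - G i j ^ 2) * ξ j =
        (∑ i, G i i * ξ i) * (∑ j, G j j * ξ j) - ∑ i, ∑ j, G i j * ξ j * (G j i * ξ i) := by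
      rw [Finset.sum_mul_sum, ← Finset.sum_sub_distrib]
      refine Finset.sum_congr rfl fun i _ => ?_
      rw [Finset.mul_sum, ← Finset.sum_sub_distrib]
      refine Finset.sum_congr rfl fun j _ => ?_
      rw [hsymm i j]
      ring
    simp only [hξ, mul_zero, Finset.sum_const_zero, hlin] at h
    linarith
  refine hW ξ (eq_zero_of_trace_eq_zero hL (weightedGram_transpose W ξ) ?_)
  rw [← hquad]
  calc ((weightedGram W a)⁻¹ * weightedGram W ξ * (weightedGram W a)⁻¹ * weightedGram W ξ).trace
      = ((weightedGram W a)⁻¹ * Wᵀ * diagonal ξ * W * (weightedGram W a)⁻¹ * Wᵀ *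
          diagonal ξ * W).trace := by simp only [weightedGram, Matrix.mul_assoc]
    _ = (G * diagonal ξ * (G * diagonal ξ)).trace := by
      rw [trace_mul_comm]
      simp only [hG, dualGram, Matrix.mul_assoc]
    _ = _ := by
      simp only [trace, diag_apply]
      refine Finset.sum_congr rfl fun i _ => ?_
      rw [Matrix.mul_apply]
      simp only [mul_diagonal]

end LinearAlgebra

end GraphLefschetz
namespace GraphLefschetz

/-! ### Exact Taylor expansion of squarefree polynomials. -/

section Multiaffine

open MvPolynomial

variable {σ : Type*} [DecidableEq σ]

theorem pderiv_prod_X (i : σ) (S : Finset σ) :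
    pderiv i (∏ e ∈ S, X e : MvPolynomial σ ℝ) = if i ∈ S then ∏ e ∈ S.erase i, X e else 0 := by
  have h : ∀ S : Finset σ, i ∉ S → pderiv i (∏ e ∈ S, X e : MvPolynomial σ ℝ) = 0 := by
    intro S hS
    induction S using Finset.induction_on with
    | empty => simp
    | insert e S he ih =>
      rw [Finset.mem_insert, not_or] at hS
      rw [Finset.prod_insert he, pderiv_mul, ih hS.2, pderiv_X_of_ne (Ne.symm hS.1)]
      simp
  split_ifs with hi
  · rw [← Finset.mul_prod_erase S _ hi, pderiv_mul, h _ (Finset.notMem_erase i S), pderiv_X_self]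
    simp
  · exact h S hi

theorem eval_add_single_prod_X (x : σ → ℝ) (i : σ) (t : ℝ) (S : Finset σ) :
    eval (x + Pi.single i t) (∏ e ∈ S, X e : MvPolynomial σ ℝ) =
      eval x (∏ e ∈ S, X e) + t * eval x (pderiv i (∏ e ∈ S, X e)) := by
  have h : ∀ S : Finset σ, i ∉ S →
      eval (x + Pi.single i t) (∏ e ∈ S, X e : MvPolynomial σ ℝ) = eval x (∏ e ∈ S, X e) := by
    intro S hS
    simp only [map_prod, eval_X]
    refine Finset.prod_congr rfl fun e he => ?_
    have : e ≠ i := fun h => hS (h ▸ he)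
    simp [this]
  rw [pderiv_prod_X]
  split_ifs with hi
  · rw [← Finset.mul_prod_erase S _ hi, map_mul, map_mul, h _ (Finset.notMem_erase i S)]
    simp
    ring
  · rw [h S hi]
    simp

variable (𝓣 : Finset (Finset σ))

theorem eval_add_single (x : σ → ℝ) (i : σ) (t : ℝ) :
    eval (x + Pi.single i t) (∑ T ∈ 𝓣, ∏ e ∈ T, X e : MvPolynomial σ ℝ) =
      eval x (∑ T ∈ 𝓣, ∏ e ∈ T, X e) + t * eval x (pderiv i (∑ T ∈ 𝓣, ∏ e ∈ T, X e)) := by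
  simp only [map_sum, eval_add_single_prod_X, Finset.sum_add_distrib, Finset.mul_sum]

theorem eval_pderiv_add_single (x : σ → ℝ) (i j : σ) (t : ℝ) :
    eval (x + Pi.single i t) (pderiv j (∑ T ∈ 𝓣, ∏ e ∈ T, X e : MvPolynomial σ ℝ)) =
      eval x (pderiv j (∑ T ∈ 𝓣, ∏ e ∈ T, X e)) +
        t * eval x (pderiv i (pderiv j (∑ T ∈ 𝓣, ∏ e ∈ T, X e))) := by
  simp only [map_sum, Finset.mul_sum, ← Finset.sum_add_distrib]
  refine Finset.sum_congr rfl fun T _ => ?_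
  rw [pderiv_prod_X]
  split_ifs
  · exact eval_add_single_prod_X x i t _
  · simp

theorem pderiv_pderiv_self (i : σ) :
    pderiv i (pderiv i (∑ T ∈ 𝓣, ∏ e ∈ T, X e : MvPolynomial σ ℝ)) = 0 := by
  simp only [map_sum]
  refine Finset.sum_eq_zero fun T _ => ?_
  rw [pderiv_prod_X]
  split_ifs
  · rw [pderiv_prod_X, if_neg (Finset.notMem_erase i T)]
  · simp

end Multiaffine

/-! ### Incidence matrices and recovery of edge weights from the Laplacian. -/

section Incidence

variable {V : Type*} (G : SimpleGraph V)

open Classical in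
/-- The incidence matrix of `G` for an arbitrary orientation of its edges. -/
noncomputable def signedIncidence (R : Type*) [CommRing R] : Matrix G.edgeSet V R :=
  fun e => Pi.single (Quot.out (e : Sym2 V)).1 1 - Pi.single (Quot.out (e : Sym2 V)).2 1

open Classical in
/-- The signed incidence matrix without the column of the vertex `v₀`. -/
noncomputable def reducedIncidence (R : Type*) [CommRing R] (v₀ : V) :
    Matrix G.edgeSet {v : V // v ≠ v₀} R :=
  (signedIncidence G R).submatrix id Subtype.val

variable {G}

open Classical in
theorem signedIncidence_eq_or (R : Type*) [CommRing R] {e : G.edgeSet} {u w : V}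
    (h : (e : Sym2 V) = s(u, w)) :
    signedIncidence G R e = Pi.single u 1 - Pi.single w 1 ∨
      signedIncidence G R e = -(Pi.single u 1 - Pi.single w 1) := by
  have h1 : s((Quot.out (e : Sym2 V)).1, (Quot.out (e : Sym2 V)).2) = s(u, w) :=
    (Quot.out_eq (e : Sym2 V)).trans h
  rcases Sym2.eq_iff.mp h1 with ⟨h1, h2⟩ | ⟨h1, h2⟩
  · exact Or.inl (by rw [signedIncidence, h1, h2])
  · exact Or.inr (by rw [signedIncidence, h1, h2, neg_sub])

theorem signedIncidence_eq_zero {R : Type*} [CommRing R] {e : G.edgeSet} {v : V}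
    (h : v ∉ (e : Sym2 V)) : signedIncidence G R e v = 0 := by
  classical
  obtain ⟨⟨u, w⟩, huw⟩ := Quot.exists_rep (e : Sym2 V)
  replace huw : (e : Sym2 V) = s(u, w) := huw.symm
  rw [huw, Sym2.mem_iff, not_or] at h
  rcases signedIncidence_eq_or R huw with h1 | h1 <;> simp [h1, h.1, h.2]

variable [Fintype V]

theorem sum_signedIncidence (R : Type*) [CommRing R] (e : G.edgeSet) :
    ∑ v, signedIncidence G R e v = 0 := by
  classical
  simp [signedIncidence]

variable [Fintype G.edgeSet]

open Classical in
-- In a simple graph only e contains both u and w, and the sign of its orientation occurs twice, so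
-- it cancels.
theorem weightedGram_signedIncidence {e : G.edgeSet} {u w : V} (h : (e : Sym2 V) = s(u, w))
    (ξ : G.edgeSet → ℝ) : weightedGram (signedIncidence G ℝ) ξ u w = -ξ e := by
  have huw : u ≠ w := by
    have := e.2
    rw [h, SimpleGraph.mem_edgeSet] at this
    exact this.ne
  rw [weightedGram_apply, Finset.sum_eq_single e]
  · rcases signedIncidence_eq_or ℝ h with h1 | h1 <;> simp [h1, huw, huw.symm]
  · intro f _ hf
    have : ¬ (u ∈ (f : Sym2 V) ∧ w ∈ (f : Sym2 V)) := by
      rw [Sym2.mem_and_mem_iff huw, ← h]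
      exact fun h => hf (Subtype.ext h)
    rcases not_and_or.mp this with h | h <;> simp [signedIncidence_eq_zero h]
  · simp

open Classical in
/-- For a simple graph the symmetric squares of the rows of the reduced incidence matrix are
linearly independent. -/
theorem eq_zero_of_weightedGram_reducedIncidence (v₀ : V) {ξ : G.edgeSet → ℝ}
    (h : weightedGram (reducedIncidence G ℝ v₀) ξ = 0) : ξ = 0 := by
  set N := weightedGram (signedIncidence G ℝ) ξ with hN
  have hred : ∀ u w, u ≠ v₀ → w ≠ v₀ → N u w = 0 := fun u w hu hw => by
    have := congrFun (congrFun h ⟨u, hu⟩) ⟨w, hw⟩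
    rw [weightedGram_apply] at this
    rw [hN, weightedGram_apply]
    exact this
  -- Zero row sums recover the entries in the deleted column from the reduced matrix.
  have hrow : ∀ u, ∑ w, N u w = 0 := fun u => by
    simp only [hN, weightedGram_apply]
    rw [Finset.sum_comm]
    refine Finset.sum_eq_zero fun e _ => ?_
    rw [← Finset.mul_sum, ← Finset.mul_sum, sum_signedIncidence, mul_zero, mul_zero]
  have hN0 : ∀ u w, u ≠ v₀ → N u w = 0 := fun u w hu => by
    by_cases hw : w = v₀
    · rw [← hrow u, hw]
      exact (Finset.sum_eq_single v₀ (fun w _ hw => hred u w hu hw) (by simp)).symm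
    · exact hred u w hu hw
  funext e
  obtain ⟨⟨u, w⟩, huw⟩ := Quot.exists_rep (e : Sym2 V)
  replace huw : (e : Sym2 V) = s(u, w) := huw.symm
  by_cases hu : u = v₀
  · have hw : w ≠ v₀ := by
      have := e.2
      rw [huw, SimpleGraph.mem_edgeSet] at this
      exact hu ▸ this.ne'
    have := hN0 w u hw
    rw [hN, weightedGram_signedIncidence (huw.trans Sym2.eq_swap)] at this
    simpa using this
  · have := hN0 u w hu
    rw [hN, weightedGram_signedIncidence huw] at this
    simpa using this

end Incidence

theorem card_ne_add_one {V : Type*} [Fintype V] [DecidableEq V] (v₀ : V) :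
    Fintype.card {v : V // v ≠ v₀} + 1 = Fintype.card V := by
  rw [← Fintype.card_option, Fintype.card_congr (Equiv.optionSubtypeNe v₀)]

/-! ### Spanning trees and the matrix tree theorem. -/

section MatrixTree

open Matrix

variable {V : Type*} {G : SimpleGraph V}

/-- The spanning subgraph of `G` with edge set `T`. -/
abbrev edgeSubgraph (T : Finset G.edgeSet) : SimpleGraph V :=
  SimpleGraph.fromEdgeSet ((fun e : G.edgeSet => (e : Sym2 V)) '' (T : Set G.edgeSet))

theorem edgeSet_edgeSubgraph (T : Finset G.edgeSet) :
    (edgeSubgraph T).edgeSet = (fun e : G.edgeSet => (e : Sym2 V)) '' (T : Set G.edgeSet) := by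
  rw [SimpleGraph.edgeSet_fromEdgeSet, sdiff_eq_left, Set.disjoint_left]
  rintro _ ⟨e, -, rfl⟩ h
  exact G.not_isDiag_of_mem_edgeSet e.2 h

theorem natCard_edgeSet_edgeSubgraph (T : Finset G.edgeSet) :
    Nat.card (edgeSubgraph T).edgeSet = T.card := by
  rw [edgeSet_edgeSubgraph, Nat.card_coe_set_eq,
    Set.ncard_image_of_injective _ Subtype.val_injective, Set.ncard_coe_finset]

theorem isSpanningTree_iff [Fintype V] (T : Finset G.edgeSet) :
    IsSpanningTree G T ↔ (edgeSubgraph T).Connected ∧ T.card + 1 = Fintype.card V := by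
  rw [← natCard_edgeSet_edgeSubgraph, ← Nat.card_eq_fintype_card]
  exact SimpleGraph.isTree_iff_connected_and_card

theorem exists_isSpanningTree [Fintype V] [Fintype G.edgeSet] (hG : G.Connected) :
    ∃ T, IsSpanningTree G T := by
  classical
  obtain ⟨H, hle, hH⟩ := hG.exists_isTree_le
  refine ⟨Finset.univ.filter fun e => (e : Sym2 V) ∈ H.edgeSet, ?_⟩
  have : edgeSubgraph (Finset.univ.filter fun e : G.edgeSet => (e : Sym2 V) ∈ H.edgeSet) = H := by
    rw [← SimpleGraph.edgeSet_inj, edgeSet_edgeSubgraph]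
    ext e
    simp only [Finset.coe_filter, Finset.mem_univ, true_and, Set.mem_image, Set.mem_ofPred_eq]
    exact ⟨by rintro ⟨f, hf, rfl⟩; exact hf,
      fun he => ⟨⟨e, SimpleGraph.edgeSet_mono hle he⟩, he, rfl⟩⟩
  change (edgeSubgraph _).IsTree
  rwa [this]

open Classical in
-- The differences telescope along a walk. Integer coefficients are what later make the tree minors
-- units.
theorem single_sub_single_mem_span {T : Finset G.edgeSet} {u w : V}
    (h : (edgeSubgraph T).Reachable u w) :
    (Pi.single u 1 - Pi.single w 1 : V → ℤ) ∈
      Submodule.span ℤ ((fun e => (signedIncidence G ℤ e : V → ℤ)) '' (T : Set G.edgeSet)) := by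
  obtain ⟨p⟩ := h
  induction p with
  | nil => simp
  | @cons u v w huv _ ih =>
    rw [← sub_add_sub_cancel _ (Pi.single v 1 : V → ℤ)]
    refine add_mem ?_ ih
    obtain ⟨⟨e, he, heq⟩, -⟩ := (SimpleGraph.fromEdgeSet_adj _).mp huv
    have hmem : (signedIncidence G ℤ e : V → ℤ) ∈
        Submodule.span ℤ ((fun e => (signedIncidence G ℤ e : V → ℤ)) '' (T : Set G.edgeSet)) :=
      Submodule.subset_span ⟨e, he, rfl⟩
    rcases signedIncidence_eq_or ℤ heq with h1 | h1
    · exact h1 ▸ hmem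
    · exact neg_mem_iff.mp (h1 ▸ hmem)

variable [Fintype V] [Fintype G.edgeSet]

open Classical in
/-- A maximal minor of the reduced incidence matrix is `±1` on the spanning trees and vanishes on
the other sets of edges. -/
theorem det_weightedGram_indicator (v₀ : V) {T : Finset G.edgeSet}
    (hT : T.card + 1 = Fintype.card V) :
    (weightedGram (reducedIncidence G ℤ v₀) fun e => if e ∈ T then 1 else 0).det =
      if IsSpanningTree G T then 1 else 0 := by
  have hcard : Fintype.card {v : V // v ≠ v₀} = Fintype.card T := by
    rw [Fintype.card_coe]
    have := card_ne_add_one v₀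
    omega
  let φ : {v : V // v ≠ v₀} ≃ T := Fintype.equivOfCardEq hcard
  let B : Matrix {v : V // v ≠ v₀} {v : V // v ≠ v₀} ℤ :=
    fun i j => signedIncidence G ℤ (φ i) j
  have hB : (weightedGram (reducedIncidence G ℤ v₀) fun e => if e ∈ T then 1 else 0) =
      Bᵀ * B := by
    ext i j
    rw [weightedGram_apply, Matrix.mul_apply]
    simp only [ite_mul, one_mul, zero_mul, transpose_apply]
    rw [Finset.sum_ite_mem, Finset.univ_inter, ← Finset.sum_coe_sort, ← φ.sum_comp]
    rfl
  rw [hB, det_mul, det_transpose]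
  split_ifs with h
  · have hconn := ((isSpanningTree_iff T).mp h).1
    -- Connectivity expresses each basis vector, modulo the `v₀` column, through rows of T, giving B
    -- an integral left inverse and hence determinant ±1.
    have hC : ∀ i : {v : V // v ≠ v₀}, ∃ c : T → ℤ, ∑ e, c e • (signedIncidence G ℤ e : V → ℤ) =
        (Pi.single (i : V) 1 - Pi.single v₀ 1 : V → ℤ) := fun i =>
      (Submodule.mem_span_image_finset_iff_exists_fun ℤ).mp
        (single_sub_single_mem_span (hconn.preconnected i v₀))
    choose c hc using hC
    have hCB : (Matrix.of fun i k => c i (φ k)) * B = 1 := by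
      ext i j
      have h1 := congrFun (hc i) j
      rw [Matrix.mul_apply, Matrix.one_apply]
      rw [Finset.sum_apply, ← φ.sum_comp] at h1
      simp only [Pi.smul_apply, smul_eq_mul, Pi.sub_apply, Pi.single_apply, j.2, if_false,
        sub_zero] at h1
      rw [show (if i = j then (1 : ℤ) else 0) = if (j : V) = i then 1 else 0 by
        simp only [Subtype.ext_iff, eq_comm], ← h1]
      rfl
    have hdet : det (Matrix.of fun i k => c i (φ k)) * B.det = 1 := by
      rw [← det_mul, hCB, det_one]
    rcases Int.isUnit_iff.mp (IsUnit.of_mul_eq_one_right _ hdet) with h1 | h1 <;> simp [h1]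
  · have hconn : ¬ (edgeSubgraph T).Connected := fun hc => h ((isSpanningTree_iff T).mpr ⟨hc, hT⟩)
    obtain ⟨u, hu⟩ : ∃ u, ¬ (edgeSubgraph T).Reachable v₀ u := by
      by_contra! hr
      have : Nonempty V := ⟨v₀⟩
      exact hconn ⟨fun a b => (hr a).symm.trans (hr b)⟩
    -- The indicator of the vertices outside the component of `v₀` is constant along edges of T and
    -- zero at `v₀`, so it restricts to a nonzero kernel vector of B.
    let f : V → ℤ := fun v => if (edgeSubgraph T).Reachable v₀ v then 0 else 1
    have hf0 : f v₀ = 0 := if_pos (SimpleGraph.Reachable.refl v₀)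
    have hsum : ∀ e ∈ T, ∑ v, signedIncidence G ℤ e v * f v = 0 := by
      intro e he
      obtain ⟨⟨a, b⟩, hab⟩ := Quot.exists_rep (e : Sym2 V)
      replace hab : (e : Sym2 V) = s(a, b) := hab.symm
      have hadj : (edgeSubgraph T).Adj a b := by
        rw [← SimpleGraph.mem_edgeSet, edgeSet_edgeSubgraph, ← hab]
        exact ⟨e, he, rfl⟩
      have hfab : f a = f b := by
        have : (edgeSubgraph T).Reachable v₀ a ↔ (edgeSubgraph T).Reachable v₀ b :=
          ⟨fun h => h.trans hadj.reachable, fun h => h.trans hadj.symm.reachable⟩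
        simp only [f, this]
      rcases signedIncidence_eq_or ℤ hab with h1 | h1 <;>
        simp [h1, sub_mul, Finset.sum_sub_distrib, Pi.single_apply, hfab]
    have hdet : B.det = 0 := by
      refine exists_mulVec_eq_zero_iff.mp ⟨fun j => f j, ?_, ?_⟩
      · intro h0
        have hne : u ≠ v₀ := fun h => hu (by rw [h])
        have := congrFun h0 ⟨u, hne⟩
        simp [f, hu] at this
      · funext i
        have h1 := hsum (φ i) (φ i).2
        rw [← Finset.add_sum_erase _ _ (Finset.mem_univ v₀), hf0, mul_zero, zero_add] at h1
        rw [Pi.zero_apply, ← h1]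
        exact (Finset.sum_subtype (Finset.univ.erase v₀) (by simp)
          fun v => signedIncidence G ℤ (φ i) v * f v).symm
    rw [hdet, mul_zero]

open Classical in
/-- The weighted **matrix tree theorem**. -/
theorem eval_kirchhoffPolynomial (v₀ : V) (x : G.edgeSet → ℝ) :
    MvPolynomial.eval x (kirchhoffPolynomial G) =
      (weightedGram (reducedIncidence G ℝ v₀) x).det := by
  have hcard := card_ne_add_one v₀
  have hcast : ∀ y : G.edgeSet → ℤ, (weightedGram (reducedIncidence G ℝ v₀) fun e => (y e : ℝ)).det
      = ((weightedGram (reducedIncidence G ℤ v₀) y).det : ℝ) := by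
    intro y
    change _ = Int.castRingHom ℝ _
    rw [RingHom.map_det]
    congr 1
    ext i j
    simp only [RingHom.mapMatrix_apply, Matrix.map_apply, weightedGram_apply, map_sum, map_mul]
    refine Finset.sum_congr rfl fun e _ => ?_
    simp [reducedIncidence, signedIncidence, Pi.single_apply]
  rw [det_weightedGram, kirchhoffPolynomial, map_sum, Finset.sum_filter]
  have hsub := Finset.subset_univ
    (Finset.powersetCard (Fintype.card {v : V // v ≠ v₀}) (Finset.univ : Finset G.edgeSet))
  rw [← Finset.sum_subset hsub]
  · refine Finset.sum_congr rfl fun T hT => ?_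
    have h1 : T.card + 1 = Fintype.card V := by rw [(Finset.mem_powersetCard.mp hT).2, hcard]
    have h2 := hcast fun e => if e ∈ T then 1 else 0
    rw [det_weightedGram_indicator v₀ h1] at h2
    push_cast at h2
    rw [h2]
    split_ifs <;> simp
  · intro T _ hT
    rw [if_neg]
    intro h
    refine hT (Finset.mem_powersetCard.mpr ⟨Finset.subset_univ _, ?_⟩)
    have := ((isSpanningTree_iff T).mp h).2
    omega

end MatrixTree

end GraphLefschetz
namespace GraphLefschetz

/-! ### The Hessian of the Kirchhoff polynomial and the conclusion. -/

section Kirchhoff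

open MvPolynomial

variable {V : Type*} [Fintype V] {G : SimpleGraph V} [Fintype G.edgeSet]

theorem isHomogeneous_kirchhoffPolynomial {r : ℕ} (hV : Fintype.card V = r + 1) :
    (kirchhoffPolynomial G).IsHomogeneous r := by
  classical
  refine IsHomogeneous.sum _ _ _ fun T hT => ?_
  have h1 := ((isSpanningTree_iff T).mp (Finset.mem_filter.mp hT).2).2
  have h2 := IsHomogeneous.prod T (fun e => (X e : MvPolynomial G.edgeSet ℝ)) (fun _ => 1)
    fun e _ => isHomogeneous_X ℝ e
  rwa [Finset.sum_const, smul_eq_mul, mul_one, show T.card = r by omega] at h2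

theorem eval_kirchhoffPolynomial_pos (hG : G.Connected) {a : G.edgeSet → ℝ} (ha : ∀ e, 0 < a e) :
    0 < eval a (kirchhoffPolynomial G) := by
  classical
  obtain ⟨T, hT⟩ := exists_isSpanningTree hG
  rw [kirchhoffPolynomial, map_sum]
  refine Finset.sum_pos (fun T _ => ?_) ⟨T, Finset.mem_filter.mpr ⟨Finset.mem_univ T, hT⟩⟩
  rw [map_prod]
  exact Finset.prod_pos fun e _ => by simpa using ha e

open Classical in
/-- The Hessian of the Kirchhoff polynomial at a point where it does not vanish. -/
theorem hessian_kirchhoffPolynomial (v₀ : V) {a : G.edgeSet → ℝ}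
    (ha : eval a (kirchhoffPolynomial G) ≠ 0) (i j : G.edgeSet) :
    eval a (pderiv i (pderiv j (kirchhoffPolynomial G))) =
      eval a (kirchhoffPolynomial G) *
        (dualGram (reducedIncidence G ℝ v₀) (weightedGram (reducedIncidence G ℝ v₀) a) i i *
          dualGram (reducedIncidence G ℝ v₀) (weightedGram (reducedIncidence G ℝ v₀) a) j j -
        dualGram (reducedIncidence G ℝ v₀) (weightedGram (reducedIncidence G ℝ v₀) a) i j ^ 2) := by
  by_cases hij : i = j
  · subst hij
    have h : pderiv i (pderiv i (kirchhoffPolynomial G)) = 0 := pderiv_pderiv_self _ i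
    rw [h, map_zero]
    ring
  -- As F is multiaffine, its mixed partial is exactly the second difference F(a+e_i+e_j) - F(a+e_i)
  -- - F(a+e_j) + F(a), and each term is an updated determinant.
  · have taylor : ∀ x e, eval (x + Pi.single e 1) (kirchhoffPolynomial G) =
        eval x (kirchhoffPolynomial G) + 1 * eval x (pderiv e (kirchhoffPolynomial G)) :=
      fun x e => eval_add_single _ x e 1
    have taylor' : eval (a + Pi.single i 1) (pderiv j (kirchhoffPolynomial G)) =
        eval a (pderiv j (kirchhoffPolynomial G)) +
          1 * eval a (pderiv i (pderiv j (kirchhoffPolynomial G))) :=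
      eval_pderiv_add_single _ a i j 1
    have hi := taylor a i
    have hj := taylor a j
    have hd := taylor (a + Pi.single i 1) j
    rw [taylor', hi] at hd
    set W := reducedIncidence G ℝ v₀
    have hF := eval_kirchhoffPolynomial (G := G) v₀
    have hu : IsUnit (weightedGram W a).det := by
      rw [isUnit_iff_ne_zero, ← hF]
      exact ha
    rw [hF, hF, weightedGram_add_single, one_smul, det_add_row W hu] at hi hj
    rw [hF, hF, weightedGram_add_single, weightedGram_add_single, one_smul, one_smul,
      det_add_two_rows W hu] at hd
    have hsymm : dualGram W (weightedGram W a) j i = dualGram W (weightedGram W a) i j :=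
      dualGram_comm W (weightedGram_transpose W a) i j
    rw [hsymm] at hd
    rw [hF]
    linear_combination hi + hj - hd

end Kirchhoff

end GraphLefschetz

theorem theorem5p9 {V : Type*} [Fintype V] (G : SimpleGraph V) [Fintype G.edgeSet]
    (hG : G.Connected) (r n : ℕ)
    (hV : Fintype.card V = r + 1) (hr : 3 ≤ r + 1)
    (hE : Fintype.card G.edgeSet = n) (hn : 3 ≤ n)
    (a : G.edgeSet → ℝ) (ha : ∀ e, 0 < a e) :
    GraphLefschetz.StrongLefschetzAt
      (GraphLefschetz.gradedPiece (GraphLefschetz.kirchhoffPolynomial G)) r 1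
      (GraphLefschetz.linearElement (GraphLefschetz.kirchhoffPolynomial G) a) := by
  classical
  obtain ⟨v₀⟩ := hG.nonempty
  have hFa := (GraphLefschetz.eval_kirchhoffPolynomial_pos hG ha).ne'
  refine GraphLefschetz.strongLefschetzAt_one_of_hessian (by omega)
    (GraphLefschetz.isHomogeneous_kirchhoffPolynomial hV) a hFa fun ξ hξ => ?_
  have hcard := GraphLefschetz.card_ne_add_one v₀
  have hdet := hFa
  rw [GraphLefschetz.eval_kirchhoffPolynomial v₀] at hdet
  -- The reduced Laplacian has size r, and r ≥ 2 excludes size 1.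
  refine GraphLefschetz.eq_zero_of_dualGram (GraphLefschetz.reducedIncidence G ℝ v₀) (by omega)
    (GraphLefschetz.posDef_weightedGram _ (fun e => (ha e).le) hdet)
    (fun ξ => GraphLefschetz.eq_zero_of_weightedGram_reducedIncidence v₀) fun i => ?_
  refine (mul_eq_zero.mp ?_).resolve_left hFa
  rw [← hξ i, Finset.mul_sum]
  refine Finset.sum_congr rfl fun j _ => ?_
  rw [GraphLefschetz.hessian_kirchhoffPolynomial v₀ hFa, mul_assoc]
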